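/- Let $(\Omega,\mathcal A,m)$ be an arbitrary measure space and let $Y$ be a (real) reflexive Banach space. Suppose that for every $\alpha\in\mathcal A$ there are given $\mu^\alpha,\nu^\alpha\in L^2(\Omega)$ and $\rho^\alpha\in Y$ such that $$\mu^\alpha\le 0\ \text{ a.e. on }\Omega\setminus\alpha,\qquad \nu^\alpha\le 0\ \text{ a.e. on }\alpha .$$ Suppose further that there are a function $c_0\in L^2(\Omega)$, a function $c_1:\mathcal A\to(0,\infty)$, a bounded linear operator $T:L^2(\Omega)\to Y$ and a constant $c_2>0$ such that, for all $\alpha\in\mathcal A$, $$\max(|\mu^\alpha+\nu^\alpha|,\nu^\alpha)\le c_0\ \text{ a.e. on }\Omega,\qquad |\nu^\alpha|\le c_1(\alpha)\,c_0\ \text{ a.e. on }\Omega,\qquad \|\rho^\alpha-T\nu^\alpha\|_Y\le c_2 .$$ Then the closed convex hull of $\{(\mu^\alpha,\nu^\alpha,\rho^\alpha) : \alpha\in\mathcal A\}$ in $L^2(\Omega)\times L^2(\Omega)\times Y$ contains a point $(\bar\mu,\bar\nu,\bar\rho)$ such that $$(\bar\mu<0\ \wedge\ \bar\nu<0)\ \vee\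 \bar\mu\,\bar\nu=0\qquad\text{a.e. on }\Omega .$$ -/

import Mathlib

open MeasureTheory

/-- A real normed space is reflexive if the canonical embedding into its bidual is onto. -/
def IsReflexiveSpace (Y : Type*) [NormedAddCommGroup Y] [NormedSpace ℝ Y] : Prop :=
  Function.Surjective (NormedSpace.inclusionInDoubleDual ℝ Y)

/-- The pointwise sign condition of M-stationarity for two real functions on a measure space. -/
def MStatSign {Ω : Type*} [MeasurableSpace Ω] (m : Measure Ω) (u v : Ω → ℝ) : Prop :=
  ∀ᵐ ω ∂m, (u ω < 0 ∧ v ω < 0) ∨ u ω * v ω = 0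

/-! The bound ‖ρ‖ ≤ ‖T‖‖ν‖ + c₂ passes to the closed convex hull, so reflexivity makes its
projection K to pairs of L² functions closed (`IsReflexiveSpace.isClosed_image_fst`). K meets every
cone `signCone m α`, and still does after discarding pairs whose second component drops below -c₀,
which makes K bounded (`exists_mem_signCone_neg_le_snd`).

There is then a point v around which sets K' ∩ `signCone m α` cluster arbitrarily tightly, with K' ⊆
K convex and still meeting all cones (`exists_forall_inter_subset_closedBall`). Given z in such an
intersection, alter α by exchanging the roles of the components wherever the one forced to be
nonpositive is well below zero, and take w ∈ K' in the new cone. A small step from z towards w stays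
in the old cone, hence in the tiny ball, so w is close to z. Thus where roles were exchanged both
components of z are nearly nonpositive, and elsewhere one nearly vanishes. In the limit v satisfies
the sign condition. -/

/-! ### Reflexivity and closed projections. -/

open Filter Topology in
/-- In a reflexive space, a decreasing sequence of nonempty closed convex bounded sets has a
common point. -/
theorem IsReflexiveSpace.nonempty_iInter {Y : Type*} [NormedAddCommGroup Y] [NormedSpace ℝ Y]
    (hY : IsReflexiveSpace Y) {C : ℕ → Set Y} (hanti : Antitone C)
    (hclosed : ∀ n, IsClosed (C n)) (hconv : ∀ n, Convex ℝ (C n))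
    (hne : ∀ n, (C n).Nonempty) {R : ℝ} (hR : ∀ y ∈ C 0, ‖y‖ ≤ R) :
    (⋂ n, C n).Nonempty := by
  choose y hy using hne
  let J : Y → WeakDual ℝ (StrongDual ℝ Y) := fun z =>
    StrongDual.toWeakDual (NormedSpace.inclusionInDoubleDual ℝ Y z)
  have hball : ∀ n, J (y n) ∈
      WeakDual.toStrongDual ⁻¹' (Metric.closedBall (0 : StrongDual ℝ (StrongDual ℝ Y)) R) := by
    intro n
    have h1 := NormedSpace.double_dual_bound ℝ Y (y n)
    have h2 := hR _ (hanti (Nat.zero_le n) (hy n))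
    exact (dist_zero_right (E := StrongDual ℝ (StrongDual ℝ Y)) _).trans_le (h1.trans h2)
  -- Banach–Alaoglu in the bidual gives a limit along an ultrafilter; reflexivity brings it back to
  -- Y.
  let U : Ultrafilter ℕ := Ultrafilter.of atTop
  obtain ⟨φ, -, hφ⟩ := (WeakDual.isCompact_closedBall (𝕜 := ℝ)
    (0 : StrongDual ℝ (StrongDual ℝ Y)) R).ultrafilter_le_nhds
    (U.map fun n => J (y n))
    (by
      rw [Ultrafilter.coe_map]
      exact (tendsto_principal.2 (Eventually.of_forall hball)))
  obtain ⟨x, hx⟩ := hY (WeakDual.toStrongDual φ)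
  have hlim : ∀ f : StrongDual ℝ Y,
      Tendsto (fun n => f (y n)) U (𝓝 (f x)) := by
    intro f
    have h1 : Tendsto (fun n => J (y n)) U (𝓝 φ) := hφ
    have h2 := ((WeakDual.eval_continuous f).tendsto φ).comp h1
    have h3 : φ f = f x := by
      have := congrArg (fun g => g f) hx
      simpa using this.symm
    rw [← h3]
    exact h2
  refine ⟨x, Set.mem_iInter.2 fun n => ?_⟩
  by_contra hxn
  obtain ⟨f, u, hu, hux⟩ := geometric_hahn_banach_closed_point (hconv n) (hclosed n) hxn
  refine absurd (le_of_tendsto (hlim f) ?_) (not_le.2 hux)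
  have : ∀ᶠ k in (atTop : Filter ℕ), f (y k) ≤ u :=
    (eventually_ge_atTop n).mono fun k hk => (hu _ (hanti hk (hy k))).le
  exact Ultrafilter.of_le atTop this

/-- Riesz representation twice: pull Φ back to E along the Riesz map and represent the result. -/
theorem isReflexiveSpace_of_innerProductSpace (E : Type*) [NormedAddCommGroup E]
    [InnerProductSpace ℝ E] [CompleteSpace E] : IsReflexiveSpace E := by
  intro Φ
  let D : E ≃ₗᵢ⋆[ℝ] StrongDual ℝ E := InnerProductSpace.toDual ℝ E
  let g : StrongDual ℝ E := LinearMap.mkContinuous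
    { toFun := fun z => Φ (D z)
      map_add' := fun z w => by simp
      map_smul' := fun c z => by simp } ‖Φ‖
    (fun z => (Φ.le_opNorm (D z)).trans_eq (by simp))
  refine ⟨D.symm g, ?_⟩
  ext f
  have h : f = D (D.symm f) := (D.apply_symm_apply f).symm
  have h2 : g (D.symm f) = Φ f := by
    change Φ (D (D.symm f)) = Φ f
    rw [← h]
  rw [NormedSpace.dual_def, ← h2]
  conv_lhs => rw [h]
  rw [InnerProductSpace.toDual_apply_apply, real_inner_comm]
  exact InnerProductSpace.toDual_symm_apply

/-- The projection along a reflexive factor of a closed convex set whose fibres are locally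
bounded is closed. -/
theorem IsReflexiveSpace.isClosed_image_fst {X Y : Type*} [NormedAddCommGroup X] [NormedSpace ℝ X]
    [NormedAddCommGroup Y] [NormedSpace ℝ Y] (hY : IsReflexiveSpace Y) {D : Set (X × Y)}
    (hclosed : IsClosed D) (hconv : Convex ℝ D) {a b : ℝ} (ha : 0 ≤ a)
    (hbd : ∀ p ∈ D, ‖p.2‖ ≤ a * ‖p.1‖ + b) : IsClosed (Prod.fst '' D) := by
  refine isClosed_of_closure_subset fun x hx => ?_
  -- Second coordinates over shrinking balls around x; a common point y of their closures puts (x,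
  -- y) in the closure of D.
  let S : ℕ → Set Y := fun n => Prod.snd '' (D ∩ Prod.fst ⁻¹' Metric.closedBall x (1 / (n + 1)))
  have hSanti : Antitone S := by
    intro i j hij
    refine Set.image_mono (Set.inter_subset_inter_right _ (Set.preimage_mono ?_))
    exact Metric.closedBall_subset_closedBall (Nat.one_div_le_one_div hij)
  have hSconv : ∀ n, Convex ℝ (S n) := fun n =>
    (hconv.inter ((convex_closedBall x _).linear_preimage (LinearMap.fst ℝ X Y))).linear_image
      (LinearMap.snd ℝ X Y)
  have hSne : ∀ n, (S n).Nonempty := by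
    intro n
    obtain ⟨_, ⟨p, hp, rfl⟩, hpx⟩ := Metric.mem_closure_iff.1 hx (1 / ((n : ℝ) + 1))
      Nat.one_div_pos_of_nat
    refine ⟨p.2, p, ⟨hp, ?_⟩, rfl⟩
    rw [Set.mem_preimage, Metric.mem_closedBall, dist_comm]
    exact hpx.le
  have hSbd : S 0 ⊆ Metric.closedBall 0 (a * (‖x‖ + 1) + b) := by
    rintro _ ⟨p, ⟨hp, hpx⟩, rfl⟩
    rw [Set.mem_preimage, Metric.mem_closedBall, dist_eq_norm] at hpx
    have h1 : ‖p.1‖ ≤ ‖x‖ + 1 := by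
      have := norm_le_norm_add_norm_sub x p.1
      rw [norm_sub_rev] at this
      norm_num at hpx
      linarith
    rw [mem_closedBall_zero_iff]
    exact (hbd p hp).trans (by gcongr)
  obtain ⟨y, hy⟩ := hY.nonempty_iInter (C := fun n => closure (S n))
    (fun i j hij => closure_mono (hSanti hij)) (fun n => isClosed_closure)
    (fun n => (hSconv n).closure) (fun n => (hSne n).closure) (R := a * (‖x‖ + 1) + b)
    (fun z hz => mem_closedBall_zero_iff.1 (closure_minimal hSbd Metric.isClosed_closedBall hz))
  refine ⟨(x, y), hclosed.closure_subset_iff.2 subset_rfl (Metric.mem_closure_iff.2 ?_), rfl⟩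
  intro ε hε
  obtain ⟨n, hn⟩ := exists_nat_one_div_lt hε
  obtain ⟨_, ⟨p, ⟨hp, hpx⟩, rfl⟩, hpy⟩ := Metric.mem_closure_iff.1 (Set.mem_iInter.1 hy n) ε hε
  refine ⟨p, hp, ?_⟩
  rw [Prod.dist_eq]
  refine max_lt ?_ hpy
  rw [Set.mem_preimage, Metric.mem_closedBall, dist_comm] at hpx
  exact hpx.trans_lt hn

/-! ### Clustering of nested convex sets in Hilbert space. -/

section Hilbert

variable {E : Type*} [NormedAddCommGroup E] [InnerProductSpace ℝ E] {ι : Type*}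

/-- `K` is a closed convex bounded set meeting every `H i`, and some `K ∩ H i` stays at distance
at least `D` from `u`; `τ` is a positive tolerance. -/
structure IsTransversalStage (H : ι → Set E) (K : Set E) (u : E) (D τ : ℝ) : Prop where
  isClosed : IsClosed K
  convex : Convex ℝ K
  isBounded : Bornology.IsBounded K
  inter_nonempty : ∀ i, (K ∩ H i).Nonempty
  pos : 0 < τ
  exists_far : ∃ i, ∀ z ∈ K ∩ H i, D ≤ ‖z - u‖

theorem exists_mem_forall_inner_le_zero [CompleteSpace E] {K : Set E} (hK : IsClosed K)
    (hc : Convex ℝ K) (hne : K.Nonempty) (u : E) :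
    ∃ v ∈ K, ∀ w ∈ K, inner ℝ (u - v) (w - v) ≤ 0 := by
  obtain ⟨v, hv, h⟩ := exists_norm_eq_iInf_of_complete_convex hne hK.isComplete hc u
  exact ⟨v, hv, (norm_eq_iInf_iff_real_inner_le_zero hc hv).1 h⟩

theorem norm_sub_le_of_inner_le_zero {u v w : E} (h : inner ℝ (u - v) (w - v) ≤ 0) :
    ‖v - u‖ ≤ ‖w - u‖ := by
  have h1 := norm_sub_sq_real (w - v) (u - v)
  rw [sub_sub_sub_cancel_right, real_inner_comm] at h1
  rw [norm_sub_rev v u]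
  refine le_of_sq_le_sq ?_ (norm_nonneg _)
  nlinarith [sq_nonneg ‖w - v‖]

/-- Shrinking a stage: the far points of the new stage lie within `ε` of a single point `v`,
and `v` is a far point of the old stage. -/
theorem IsTransversalStage.exists_next [CompleteSpace E] {H : ι → Set E}
    (hHclosed : ∀ i, IsClosed (H i)) (hHconv : ∀ i, Convex ℝ (H i)) {K : Set E} {u : E} {D τ : ℝ}
    (h : IsTransversalStage H K u D τ) {ε : ℝ} (hε : 0 < ε) :
    ∃ (K' : Set E) (u' : E) (D' τ' : ℝ) (v : E), IsTransversalStage H K' u' D' τ' ∧ K' ⊆ K ∧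
      v ∈ K' ∧ D - τ ≤ ‖v - u‖ ∧ ∀ z ∈ K', D' - τ' ≤ ‖z - u'‖ → ‖z - v‖ ≤ ε := by
  obtain ⟨i₀, hi₀⟩ := h.exists_far
  have hnear : ∀ i, ∃ v ∈ K ∩ H i, ∀ w ∈ K ∩ H i, inner ℝ (u - v) (w - v) ≤ 0 := fun i =>
    exists_mem_forall_inner_le_zero (h.isClosed.inter (hHclosed i)) (h.convex.inter (hHconv i))
      (h.inter_nonempty i) u
  choose p hp hpin using hnear
  obtain ⟨R, hR⟩ := h.isBounded.subset_closedBall u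
  have hbdd : BddAbove (Set.range fun i => ‖p i - u‖) := by
    refine ⟨R, ?_⟩
    rintro _ ⟨i, rfl⟩
    simpa [dist_eq_norm] using hR (hp i).1
  set r := ⨆ i, ‖p i - u‖ with hr
  have hle : ∀ i, ‖p i - u‖ ≤ r := fun i => le_ciSup hbdd i
  have hr0 : 0 ≤ r := (norm_nonneg _).trans (hle i₀)
  set τ' := ε ^ 2 / (8 * (r + 1)) with hτ'
  have hτ'0 : 0 < τ' := by positivity
  have hδ : 0 < min τ τ' := lt_min h.pos hτ'0
  have : Nonempty ι := ⟨i₀⟩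
  -- The ball of radius r about u keeps every p i, while `H j` is almost as far from u as that ball
  -- allows.
  obtain ⟨j, hj⟩ := exists_lt_of_lt_ciSup (show r - min τ τ' < ⨆ i, ‖p i - u‖ by linarith)
  have hmem : ∀ i, p i ∈ K ∩ Metric.closedBall u r := fun i =>
    ⟨(hp i).1, by simpa [dist_eq_norm] using hle i⟩
  -- The new centre is the reflection of p j in u: the obtuse angle at p j keeps K ∩ H j at distance
  -- at least 2‖p j - u‖ from it.
  refine ⟨K ∩ Metric.closedBall u r, (2 : ℝ) • u - p j, 2 * ‖p j - u‖, τ', p j, ?_,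
    Set.inter_subset_left, hmem j, ?_, ?_⟩
  · refine ⟨h.isClosed.inter Metric.isClosed_closedBall, h.convex.inter (convex_closedBall _ _),
      h.isBounded.subset Set.inter_subset_left, fun i => ⟨p i, hmem i, (hp i).2⟩, hτ'0, j, ?_⟩
    rintro z ⟨⟨hzK, -⟩, hzH⟩
    have h1 := hpin j z ⟨hzK, hzH⟩
    have h2 : z - ((2 : ℝ) • u - p j) = (z - p j) - (2 : ℝ) • (u - p j) := by module
    have h3 := norm_sub_sq_real (z - p j) ((2 : ℝ) • (u - p j))
    rw [← h2, inner_smul_right, real_inner_comm, norm_smul, Real.norm_ofNat,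
      norm_sub_rev u] at h3
    refine le_of_sq_le_sq ?_ (norm_nonneg _)
    nlinarith [sq_nonneg ‖z - p j‖]
  · have h1 := hi₀ _ (hp i₀)
    have h2 := hle i₀
    have h3 := min_le_left τ τ'
    linarith
  · rintro z ⟨-, hz⟩ hzu
    rw [Metric.mem_closedBall, dist_eq_norm] at hz
    -- Uniform convexity: ‖z - p j‖² ≤ 2r² + 2d² - e² ≤ 8rτ', which the choice of τ' keeps below ε².
    have h1 := parallelogram_law_with_norm ℝ (z - u) (p j - u)
    have h2 : z - u + (p j - u) = z - ((2 : ℝ) • u - p j) := by module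
    rw [h2, sub_sub_sub_cancel_right] at h1
    have h3 := hle j
    have h4 := min_le_right τ τ'
    have h5 : 8 * (r + 1) * τ' = ε ^ 2 := by rw [hτ']; field_simp
    set d := ‖p j - u‖
    set e := ‖z - ((2 : ℝ) • u - p j)‖
    have hd0 : 0 ≤ d := norm_nonneg _
    have h6 : 4 * d ^ 2 - 4 * d * τ' ≤ e ^ 2 := by
      rcases le_total τ' (2 * d) with h7 | h7
      · nlinarith [mul_self_le_mul_self (sub_nonneg.2 h7) hzu, sq_nonneg τ']
      · nlinarith [sq_nonneg e, mul_nonneg hd0 (sub_nonneg.2 h7), mul_nonneg hd0 hτ'0.le]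
    have h7 : ‖z - u‖ ^ 2 ≤ r ^ 2 := pow_le_pow_left₀ (norm_nonneg _) hz 2
    have h8 : (r - d) * (r + d) ≤ τ' * (2 * r) :=
      mul_le_mul (by linarith) (by linarith) (by linarith) hτ'0.le
    have h9 : d * τ' ≤ r * τ' := mul_le_mul_of_nonneg_right h3 hτ'0.le
    refine le_of_sq_le_sq ?_ hε.le
    nlinarith

/-- If a closed convex bounded set `K` meets all the closed convex sets `H i`, then some `v ∈ K`
is approximated arbitrarily well by `K' ∩ H i` for closed convex `K' ⊆ K` still meeting all of
them. -/
theorem exists_forall_inter_subset_closedBall [CompleteSpace E] [Nonempty ι] {H : ι → Set E}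
    (hHclosed : ∀ i, IsClosed (H i)) (hHconv : ∀ i, Convex ℝ (H i)) {K : Set E}
    (hK : IsClosed K) (hKconv : Convex ℝ K) (hKb : Bornology.IsBounded K)
    (hKH : ∀ i, (K ∩ H i).Nonempty) :
    ∃ v ∈ K, ∀ ε > 0, ∃ K' ⊆ K, Convex ℝ K' ∧ (∀ i, (K' ∩ H i).Nonempty) ∧
      ∃ i, K' ∩ H i ⊆ Metric.closedBall v ε := by
  let S := {p : Set E × E × ℝ × ℝ // IsTransversalStage H p.1 p.2.1 p.2.2.1 p.2.2.2}
  have hstep : ∀ (n : ℕ) (s : S), ∃ (s' : S) (v : E), s'.1.1 ⊆ s.1.1 ∧ v ∈ s'.1.1 ∧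
      s.1.2.2.1 - s.1.2.2.2 ≤ ‖v - s.1.2.1‖ ∧
      ∀ z ∈ s'.1.1, s'.1.2.2.1 - s'.1.2.2.2 ≤ ‖z - s'.1.2.1‖ → ‖z - v‖ ≤ 1 / 2 / 2 ^ n := by
    intro n s
    obtain ⟨K', u', D', τ', v, h1, h2⟩ := s.2.exists_next hHclosed hHconv
      (ε := 1 / 2 / 2 ^ n) (by positivity)
    exact ⟨⟨(K', u', D', τ'), h1⟩, v, h2⟩
  choose next pt hsub hpt hfar hnear using hstep
  -- With D = 0 the distance condition is vacuous.
  let s₀ : S := ⟨(K, 0, 0, 1), hK, hKconv, hKb, hKH, one_pos,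
    Classical.arbitrary ι, fun z _ => norm_nonneg _⟩
  let s : ℕ → S := fun n => Nat.rec s₀ next n
  let v : ℕ → E := fun n => pt n (s n)
  -- v (n + 1) is itself a far point of stage n + 1, and all those lie near v n.
  have hdist : ∀ n, dist (v n) (v (n + 1)) ≤ 1 / 2 / 2 ^ n := by
    intro n
    rw [dist_comm, dist_eq_norm]
    exact hnear n (s n) _ (hsub (n + 1) (s (n + 1)) (hpt (n + 1) (s (n + 1))))
      (hfar (n + 1) (s (n + 1)))
  have hsK : ∀ n, (s n).1.1 ⊆ K := by
    intro n
    induction n with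
    | zero => exact subset_rfl
    | succ n ih => exact (hsub n (s n)).trans ih
  obtain ⟨w, hw⟩ := cauchySeq_tendsto_of_complete (cauchySeq_of_le_geometric_two hdist)
  refine ⟨w, hK.mem_of_tendsto hw (Filter.Eventually.of_forall fun n : ℕ =>
    hsK (n + 1) (hpt n (s n))), fun ε hε => ?_⟩
  obtain ⟨n, hn⟩ := exists_pow_lt_of_lt_one (half_pos hε) (show (1 / 2 : ℝ) < 1 by norm_num)
  obtain ⟨i, hi⟩ := (s (n + 1)).2.exists_far
  refine ⟨(s (n + 1)).1.1, hsK (n + 1), (s (n + 1)).2.convex, (s (n + 1)).2.inter_nonempty, i,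
    fun z hz => ?_⟩
  have h1 : ‖z - v n‖ ≤ 1 / 2 / 2 ^ n := hnear n (s n) z hz.1
    (by linarith [hi z hz, (s (n + 1)).2.pos])
  have h2 := dist_le_of_le_geometric_two_of_tendsto hdist hw n
  have h3 : (1 : ℝ) / 2 ^ n < ε / 2 := by simpa [one_div] using hn
  have h4 : (1 : ℝ) / 2 / 2 ^ n = 1 / 2 ^ n / 2 := by ring
  rw [← dist_eq_norm] at h1
  rw [Metric.mem_closedBall]
  have h5 := dist_triangle z (v n) w
  have h6 : (0 : ℝ) < 1 / 2 ^ n := by positivity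
  linarith

end Hilbert

/-! ### Pairs of L² functions and the sign cones. -/

section PairL2

variable {Ω : Type*} [MeasurableSpace Ω] {m : Measure Ω}

/-- The `L²` functions that are almost everywhere on `s` at most `g`. -/
def aeLeOn (m : Measure Ω) (s : Set Ω) (g : Ω → ℝ) : Set (Lp ℝ 2 m) :=
  {f | ∀ᵐ ω ∂m, ω ∈ s → f ω ≤ g ω}

/-- An L² convergent sequence has an a.e. convergent subsequence. -/
theorem isClosed_aeLeOn (s : Set Ω) (g : Ω → ℝ) : IsClosed (aeLeOn m s g) := by
  rw [← isSeqClosed_iff_isClosed]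
  intro f f₀ hf hlim
  obtain ⟨ns, -, hns⟩ := (tendstoInMeasure_of_tendsto_Lp hlim).exists_seq_tendsto_ae
  filter_upwards [hns, ae_all_iff.2 hf] with ω h1 h2 hω
  exact le_of_tendsto h1 (Filter.Eventually.of_forall fun i => h2 (ns i) hω)

theorem aeLeOn_anti {s t : Set Ω} (h : s ⊆ t) (g : Ω → ℝ) : aeLeOn m t g ⊆ aeLeOn m s g := by
  intro f (hf : ∀ᵐ ω ∂m, ω ∈ t → f ω ≤ g ω)
  exact show ∀ᵐ ω ∂m, ω ∈ s → f ω ≤ g ω from hf.mono fun ω hω hs => hω (h hs)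

theorem convex_aeLeOn (s : Set Ω) (g : Ω → ℝ) : Convex ℝ (aeLeOn m s g) := by
  intro f hf f' hf' a b ha hb hab
  filter_upwards [hf, hf', Lp.coeFn_add (a • f) (b • f'), Lp.coeFn_smul a f,
    Lp.coeFn_smul b f'] with ω h1 h2 h3 h4 h5 hω
  rw [h3, Pi.add_apply, h4, h5, Pi.smul_apply, Pi.smul_apply, smul_eq_mul, smul_eq_mul]
  calc a * f ω + b * f' ω ≤ a * g ω + b * g ω :=
        add_le_add (mul_le_mul_of_nonneg_left (h1 hω) ha) (mul_le_mul_of_nonneg_left (h2 hω) hb)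
    _ = g ω := by rw [← add_mul, hab, one_mul]

theorem isClosed_preimage_aeLeOn {X : Type*} [NormedAddCommGroup X] [NormedSpace ℝ X]
    (Λ : X →L[ℝ] Lp ℝ 2 m) (s : Set Ω) (g : Ω → ℝ) : IsClosed (Λ ⁻¹' aeLeOn m s g) :=
  (isClosed_aeLeOn s g).preimage Λ.continuous

theorem convex_preimage_aeLeOn {X : Type*} [NormedAddCommGroup X] [NormedSpace ℝ X]
    (Λ : X →L[ℝ] Lp ℝ 2 m) (s : Set Ω) (g : Ω → ℝ) : Convex ℝ (Λ ⁻¹' aeLeOn m s g) :=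
  (convex_aeLeOn s g).linear_preimage Λ.toLinearMap

theorem norm_le_of_ae_abs_le {f g : Lp ℝ 2 m} (h : ∀ᵐ ω ∂m, |f ω| ≤ g ω) : ‖f‖ ≤ ‖g‖ :=
  Lp.norm_le_norm_of_ae_le (h.mono fun _ hω => hω.trans (le_abs_self _))

/-- The Hilbert space of pairs of `L²` functions. -/
abbrev PairL2 (m : Measure Ω) : Type _ := WithLp 2 (Lp ℝ 2 m × Lp ℝ 2 m)

theorem PairL2.norm_le (z : PairL2 m) : ‖z‖ ≤ ‖z.fst‖ + ‖z.snd‖ := by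
  refine le_of_sq_le_sq ?_ (by positivity)
  rw [WithLp.prod_norm_sq_eq_of_L2]
  nlinarith [norm_nonneg z.fst, norm_nonneg z.snd]

/-- The pairs whose first component is nonpositive off `α` and whose second component is
nonpositive on `α`. -/
def signCone (m : Measure Ω) (α : Set Ω) : Set (PairL2 m) :=
  WithLp.fstL 2 ℝ _ _ ⁻¹' aeLeOn m αᶜ 0 ∩ WithLp.sndL 2 ℝ _ _ ⁻¹' aeLeOn m α 0

theorem isClosed_signCone (α : Set Ω) : IsClosed (signCone m α) :=
  (isClosed_preimage_aeLeOn _ _ _).inter (isClosed_preimage_aeLeOn _ _ _)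

theorem convex_signCone (α : Set Ω) : Convex ℝ (signCone m α) :=
  (convex_preimage_aeLeOn _ _ _).inter (convex_preimage_aeLeOn _ _ _)

/-- The differences `z.snd - b` with `z ∈ K`, `z.fst ≤ 0` on `s` and `-c ≤ b ≤ U`. -/
def sndSubInterval (K : Set (PairL2 m)) (s : Set Ω) (c U : Lp ℝ 2 m) : Set (Lp ℝ 2 m) :=
  {w | ∃ z ∈ K, z.fst ∈ aeLeOn m s 0 ∧ z.snd - w ∈ aeLeOn m Set.univ U ∧
    w - z.snd ∈ aeLeOn m Set.univ c}

theorem ae_mem_Icc_of_mem_aeLeOn {f w c U : Lp ℝ 2 m} (h1 : f - w ∈ aeLeOn m Set.univ U)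
    (h2 : w - f ∈ aeLeOn m Set.univ c) : ∀ᵐ ω ∂m, f ω - w ω ≤ U ω ∧ -c ω ≤ f ω - w ω := by
  filter_upwards [h1, h2, Lp.coeFn_sub f w, Lp.coeFn_sub w f] with ω h3 h4 h5 h6
  have h3 := h3 trivial
  have h4 := h4 trivial
  rw [h5, Pi.sub_apply] at h3
  rw [h6, Pi.sub_apply] at h4
  exact ⟨h3, by linarith⟩

/-- K may be unbounded, but w and the interval control z.snd, and then |z.fst + z.snd| ≤ c controls
z.fst; so the set is a projection with locally bounded Hilbert fibres. -/
theorem isClosed_convex_sndSubInterval {K : Set (PairL2 m)} (hK : IsClosed K)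
    (hKconv : Convex ℝ K) (s : Set Ω) {c U : Lp ℝ 2 m}
    (hc : ∀ z ∈ K, ∀ᵐ ω ∂m, |z.fst ω + z.snd ω| ≤ c ω) (hU : ∀ᵐ ω ∂m, U ω ≤ c ω) :
    IsClosed (sndSubInterval K s c U) ∧ Convex ℝ (sndSubInterval K s c U) := by
  obtain ⟨P, hP⟩ : ∃ P : Lp ℝ 2 m × PairL2 m →L[ℝ] Lp ℝ 2 m, ∀ p, P p = p.2.fst :=
    ⟨(WithLp.fstL 2 ℝ _ _).comp (ContinuousLinearMap.snd ℝ _ _), fun _ => rfl⟩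
  obtain ⟨Q, hQ⟩ : ∃ Q : Lp ℝ 2 m × PairL2 m →L[ℝ] Lp ℝ 2 m, ∀ p, Q p = p.2.snd - p.1 :=
    ⟨(WithLp.sndL 2 ℝ _ _).comp (ContinuousLinearMap.snd ℝ _ _) -
      ContinuousLinearMap.fst ℝ _ _, fun _ => rfl⟩
  have hQneg : ∀ p, (-Q) p = p.1 - p.2.snd := fun p => by
    rw [neg_apply, hQ, neg_sub]
  obtain ⟨D, hDdef⟩ : ∃ D : Set (Lp ℝ 2 m × PairL2 m), D = Prod.snd ⁻¹' K ∩
    (P ⁻¹' aeLeOn m s 0 ∩ (Q ⁻¹' aeLeOn m Set.univ U ∩ (-Q) ⁻¹' aeLeOn m Set.univ c)) := ⟨_, rfl⟩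
  have hmem : ∀ p, p ∈ D ↔ p.2 ∈ K ∧ p.2.fst ∈ aeLeOn m s 0 ∧
      p.2.snd - p.1 ∈ aeLeOn m Set.univ U ∧ p.1 - p.2.snd ∈ aeLeOn m Set.univ c := by
    intro p
    rw [hDdef, Set.mem_inter_iff, Set.mem_inter_iff, Set.mem_inter_iff, Set.mem_preimage,
      Set.mem_preimage, Set.mem_preimage, Set.mem_preimage, hP, hQ, hQneg]
  have hD : IsClosed D := by
    rw [hDdef]
    exact (hK.preimage continuous_snd).inter ((isClosed_preimage_aeLeOn _ _ _).inter
      ((isClosed_preimage_aeLeOn _ _ _).inter (isClosed_preimage_aeLeOn _ _ _)))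
  have hDconv : Convex ℝ D := by
    rw [hDdef]
    exact (hKconv.linear_preimage (LinearMap.snd ℝ _ _)).inter
      ((convex_preimage_aeLeOn _ _ _).inter
        ((convex_preimage_aeLeOn _ _ _).inter (convex_preimage_aeLeOn _ _ _)))
  have hDbd : ∀ p ∈ D, ‖p.2‖ ≤ 2 * ‖p.1‖ + 3 * ‖c‖ := by
    intro p hp
    obtain ⟨hp1, -, hp2, hp3⟩ := (hmem p).1 hp
    have h1 : ‖p.2.snd - p.1‖ ≤ ‖c‖ := by
      refine norm_le_of_ae_abs_le ?_
      filter_upwards [ae_mem_Icc_of_mem_aeLeOn hp2 hp3, hU, Lp.coeFn_sub p.2.snd p.1]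
        with ω h1 h2 h4
      rw [h4, Pi.sub_apply, abs_le]
      exact ⟨h1.2, h1.1.trans h2⟩
    have h2 : ‖p.2.fst + p.2.snd‖ ≤ ‖c‖ := by
      refine norm_le_of_ae_abs_le ?_
      filter_upwards [hc p.2 hp1, Lp.coeFn_add p.2.fst p.2.snd] with ω h1 h2
      rw [h2]
      exact h1
    have h3 := PairL2.norm_le p.2
    have h4 := norm_sub_le (p.2.fst + p.2.snd) p.2.snd
    have h5 := norm_add_le (p.2.snd - p.1) p.1
    rw [add_sub_cancel_right] at h4
    rw [sub_add_cancel] at h5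
    linarith
  have himage : sndSubInterval K s c U = Prod.fst '' D := by
    ext w
    constructor
    · rintro ⟨z, hz⟩
      exact ⟨(w, z), (hmem _).2 hz, rfl⟩
    · rintro ⟨p, hp, rfl⟩
      exact ⟨p.2, (hmem p).1 hp⟩
  rw [himage]
  exact ⟨(isReflexiveSpace_of_innerProductSpace (PairL2 m)).isClosed_image_fst hD hDconv
    zero_le_two hDbd, hDconv.linear_image (LinearMap.fst ℝ _ _)⟩

theorem sub_clamp_mem_sndSubInterval {K : Set (PairL2 m)} {s : Set Ω} {c U : Lp ℝ 2 m}
    (hcU : ∀ᵐ ω ∂m, -c ω ≤ U ω) {z : PairL2 m} (hz : z ∈ K) (hzs : z.fst ∈ aeLeOn m s 0) :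
    z.snd - (z.snd ⊓ U) ⊔ (-c) ∈ sndSubInterval K s c U := by
  refine ⟨z, hz, hzs, ?_, ?_⟩
  · rw [sub_sub_cancel]
    filter_upwards [Lp.coeFn_sup (z.snd ⊓ U) (-c), Lp.coeFn_inf z.snd U, Lp.coeFn_neg c, hcU]
      with ω h2 h3 h4 h5 _
    rw [h2, Pi.sup_apply, h3, Pi.inf_apply, h4, Pi.neg_apply]
    exact sup_le inf_le_right h5
  · rw [sub_sub_cancel_left]
    filter_upwards [Lp.coeFn_sup (z.snd ⊓ U) (-c), Lp.coeFn_neg c,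
      Lp.coeFn_neg ((z.snd ⊓ U) ⊔ (-c))] with ω h2 h3 h4 _
    rw [h4, Pi.neg_apply, h2, Pi.sup_apply, h3, Pi.neg_apply]
    exact neg_le.1 le_sup_right

/-- A closed convex set of pairs with `|f + g| ≤ c` and `g ≤ c` that meets all the cones
`signCone m β` also contains points of each cone whose second component is at least `-c`. -/
theorem exists_mem_signCone_neg_le_snd {K : Set (PairL2 m)} (hK : IsClosed K)
    (hKconv : Convex ℝ K) {c : Lp ℝ 2 m}
    (hc : ∀ z ∈ K, ∀ᵐ ω ∂m, |z.fst ω + z.snd ω| ≤ c ω ∧ z.snd ω ≤ c ω)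
    (hcone : ∀ β, MeasurableSet β → (K ∩ signCone m β).Nonempty) {α : Set Ω}
    (hα : MeasurableSet α) :
    ∃ z ∈ K ∩ signCone m α, ∀ᵐ ω ∂m, -c ω ≤ z.snd ω := by
  have hc0 : ∀ᵐ ω ∂m, 0 ≤ c ω := by
    obtain ⟨z, hz⟩ := hcone α hα
    exact (hc z hz.1).mono fun ω h => (abs_nonneg _).trans h.1
  -- An upper bound U means nonpositive on α and at most c elsewhere, so the goal becomes 0 ∈
  -- `sndSubInterval K αᶜ c U`.
  obtain ⟨U, hU⟩ : ∃ U : Lp ℝ 2 m, ∀ᵐ ω ∂m, U ω = αᶜ.indicator c ω :=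
    ⟨((Lp.memLp c).indicator hα.compl).toLp, MemLp.coeFn_toLp _⟩
  have hUc : ∀ᵐ ω ∂m, U ω ≤ c ω := by
    filter_upwards [hU, hc0] with ω h1 h2
    exact h1.trans_le (Set.indicator_le_self' (fun _ _ => h2) ω)
  have hcU : ∀ᵐ ω ∂m, -c ω ≤ U ω := by
    filter_upwards [hU, hc0] with ω h1 h2
    rw [h1]
    exact (neg_nonpos.2 h2).trans (Set.indicator_apply_nonneg fun _ => h2)
  obtain ⟨hM, hMconv⟩ := isClosed_convex_sndSubInterval hK hKconv αᶜ
    (fun z hz => (hc z hz).mono fun _ h => h.1) hUc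
  have hbest : ∀ β ⊆ α, ∀ z ∈ K ∩ signCone m β,
      z.snd - (z.snd ⊓ U) ⊔ (-c) ∈ sndSubInterval K αᶜ c U := fun β hβα z hz =>
    sub_clamp_mem_sndSubInterval hcU hz.1 (aeLeOn_anti (Set.compl_subset_compl.2 hβα) 0 hz.2.1)
  obtain ⟨d, hd, hdmin⟩ := exists_mem_forall_inner_le_zero hM hMconv
    ((hcone ∅ MeasurableSet.empty).elim fun z hz => ⟨_, hbest ∅ (Set.empty_subset _) z hz⟩) 0
  have hd0 : d = 0 := by
    have hβ : MeasurableSet {ω | 0 < d ω} :=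
      measurableSet_lt measurable_const (Lp.stronglyMeasurable d).measurable
    -- Test the minimal-norm element d with this cone: z.snd ≤ U where d > 0, and elsewhere z.fst ≤
    -- 0 forces z.snd ≥ -c. The clamping error thus has sign opposite to d, whereas minimality gives
    -- it inner product at least ‖d‖² with d.
    obtain ⟨z, hz⟩ := hcone (α ∩ {ω | 0 < d ω}) (hα.inter hβ)
    have h1 := hdmin _ (hbest _ Set.inter_subset_left z hz)
    have h2 : inner ℝ d (z.snd - (z.snd ⊓ U) ⊔ (-c)) ≤ 0 := by
      rw [L2.inner_def]
      refine integral_nonpos_of_ae ?_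
      filter_upwards [hz.2.1, hz.2.2, hc z hz.1, hU, Lp.coeFn_sup (z.snd ⊓ U) (-c),
        Lp.coeFn_inf z.snd U, Lp.coeFn_neg c, Lp.coeFn_sub z.snd ((z.snd ⊓ U) ⊔ (-c))]
        with ω h3 h4 h5 h6 h7 h8 h9 h10
      have h3' : ω ∈ (α ∩ {ω | 0 < d ω})ᶜ → z.fst ω ≤ 0 := h3
      have h4' : ω ∈ α ∩ {ω | 0 < d ω} → z.snd ω ≤ 0 := h4
      rw [h10, Pi.sub_apply, h7, Pi.sup_apply, h8, Pi.inf_apply, h9, Pi.neg_apply,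
        RCLike.inner_apply, conj_trivial,
        mul_comm, Pi.zero_apply]
      rcases lt_or_ge 0 (d ω) with hω | hω
      · refine mul_nonpos_of_nonneg_of_nonpos hω.le (sub_nonpos.2 ?_)
        refine (le_inf le_rfl ?_).trans le_sup_left
        rw [h6]
        by_cases hωα : ω ∈ α
        · rw [Set.indicator_of_notMem (by simpa using hωα)]
          exact h4' ⟨hωα, hω⟩
        · rw [Set.indicator_of_mem hωα]
          exact h5.2
      · refine mul_nonpos_of_nonpos_of_nonneg hω (sub_nonneg.2 (sup_le inf_le_left ?_))
        have := h3' fun h => absurd h.2 (not_lt.2 hω)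
        linarith [(abs_le.1 h5.1).1]
    rw [zero_sub, inner_neg_left, inner_sub_right, real_inner_self_eq_norm_sq] at h1
    have h3 : ‖d‖ ^ 2 ≤ 0 := by linarith
    exact norm_eq_zero.1 (pow_eq_zero_iff two_ne_zero |>.1 (le_antisymm h3 (sq_nonneg _)))
  obtain ⟨z, hz, hz1, hz2, hz3⟩ := hd
  have hle := ae_mem_Icc_of_mem_aeLeOn hz2 hz3
  have hp0 := Lp.coeFn_zero ℝ 2 m
  rw [← hd0] at hp0
  refine ⟨z, ⟨hz, hz1, ?_⟩, ?_⟩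
  · filter_upwards [hle, hU, hp0] with ω h1 h2 h3 hω
    have h4 := h1.1
    rw [h2, h3, Set.indicator_of_notMem (by simpa using hω), Pi.zero_apply, sub_zero] at h4
    exact h4
  · filter_upwards [hle, hp0] with ω h1 h3
    have h4 := h1.2
    rwa [h3, Pi.zero_apply, sub_zero] at h4

/-! ### Violation of the sign condition. -/

/-- A nonnegative function that vanishes exactly where both numbers are negative or one of them
is zero. -/
noncomputable def signDefect (x y : ℝ) : ℝ := max 0 (min (min |x| |y|) (max x y))

theorem signDefect_le {x y e : ℝ} (he : 0 ≤ e) (h : |x| ≤ e ∨ |y| ≤ e ∨ x ≤ e ∧ y ≤ e) :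
    signDefect x y ≤ e := by
  refine max_le he ?_
  rcases h with h | h | h
  · exact (min_le_left _ _).trans ((min_le_left _ _).trans h)
  · exact (min_le_left _ _).trans ((min_le_right _ _).trans h)
  · exact (min_le_right _ _).trans (max_le h.1 h.2)

theorem neg_and_neg_or_mul_eq_zero_of_signDefect_le_zero {x y : ℝ} (h : signDefect x y ≤ 0) :
    x < 0 ∧ y < 0 ∨ x * y = 0 := by
  by_cases hxy : x * y = 0
  · exact Or.inr hxy
  obtain ⟨hx, hy⟩ := mul_ne_zero_iff.1 hxy
  rcases min_le_iff.1 ((le_max_right _ _).trans h) with h | h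
  · exact absurd h (not_le.2 (lt_min (abs_pos.2 hx) (abs_pos.2 hy)))
  · exact Or.inl ⟨lt_of_le_of_ne ((le_max_left _ _).trans h) hx,
      lt_of_le_of_ne ((le_max_right _ _).trans h) hy⟩

theorem ae_fst_nonpos_of_mem_signCone {α : Set Ω} {z : PairL2 m} (hz : z ∈ signCone m α) :
    ∀ᵐ ω ∂m, ω ∉ α → z.fst ω ≤ 0 := hz.1

theorem ae_snd_nonpos_of_mem_signCone {α : Set Ω} {z : PairL2 m} (hz : z ∈ signCone m α) :
    ∀ᵐ ω ∂m, ω ∈ α → z.snd ω ≤ 0 := hz.2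

/-- Let `K` be convex, bounded by `c` and meet all the cones. A point `z` of `K ∩ signCone m α`
can be moved inside this set a fraction `δ / 3` of the way towards a point `w ∈ K` that controls
the violation of the sign condition by `z`. -/
theorem exists_mem_combo_mem_signCone {K : Set (PairL2 m)} {c : Lp ℝ 2 m}
    (hc : ∀ z ∈ K, ∀ᵐ ω ∂m, |z.fst ω + z.snd ω| ≤ c ω ∧ |z.snd ω| ≤ c ω)
    (hcone : ∀ β, MeasurableSet β → (K ∩ signCone m β).Nonempty) {α : Set Ω}
    (hα : MeasurableSet α) {z : PairL2 m} (hz : z ∈ K ∩ signCone m α) {δ : ℝ} (hδ : 0 < δ)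
    (hδ1 : δ ≤ 1) :
    ∃ w ∈ K, (1 - δ / 3) • z + (δ / 3) • w ∈ signCone m α ∧
      ∀ᵐ ω ∂m, |z.fst ω| ≤ δ * c ω ∨ |z.snd ω| ≤ δ * c ω ∨
        z.fst ω ≤ |w.fst ω - z.fst ω| + |w.snd ω - z.snd ω| ∧
          z.snd ω ≤ |w.fst ω - z.fst ω| + |w.snd ω - z.snd ω| := by
  have hmc : Measurable fun ω => -(δ * c ω) :=
    ((Lp.stronglyMeasurable c).measurable.const_mul δ).neg
  have hA : MeasurableSet {ω | z.fst ω ≤ -(δ * c ω)} :=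
    measurableSet_le (Lp.stronglyMeasurable z.fst).measurable hmc
  have hB : MeasurableSet {ω | z.snd ω ≤ -(δ * c ω)} :=
    measurableSet_le (Lp.stronglyMeasurable z.snd).measurable hmc
  -- Points switch sides exactly where the component forced to be nonpositive is at most -δc.
  obtain ⟨w, hwK, hw⟩ := hcone ((α \ {ω | z.snd ω ≤ -(δ * c ω)}) ∪
    ({ω | z.fst ω ≤ -(δ * c ω)} \ α)) ((hα.diff hB).union (hA.diff hα))
  have hw1 := ae_fst_nonpos_of_mem_signCone hw
  have hw2 := ae_snd_nonpos_of_mem_signCone hw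
  have hz1 := ae_fst_nonpos_of_mem_signCone hz.2
  have hz2 := ae_snd_nonpos_of_mem_signCone hz.2
  refine ⟨w, hwK, ⟨?_, ?_⟩, ?_⟩
  · have hfst : ((1 - δ / 3) • z + (δ / 3) • w).fst =ᵐ[m]
        fun ω => (1 - δ / 3) * z.fst ω + δ / 3 * w.fst ω := by
      rw [WithLp.add_fst, WithLp.smul_fst, WithLp.smul_fst]
      filter_upwards [Lp.coeFn_add ((1 - δ / 3) • z.fst) ((δ / 3) • w.fst),
        Lp.coeFn_smul (1 - δ / 3) z.fst, Lp.coeFn_smul (δ / 3) w.fst] with ω h1 h2 h3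
      rw [h1, Pi.add_apply, h2, h3]
      rfl
    filter_upwards [hfst, hw1, hz1, hc z hz.1, hc w hwK] with ω h1 h2 h3 h4 h5 hω
    rw [WithLp.fstL_apply, h1, Pi.zero_apply]
    have h6 := h3 hω
    by_cases h7 : z.fst ω ≤ -(δ * c ω)
    · have h8 := abs_le.1 h5.1
      have h9 := abs_le.1 h5.2
      have h10 : 0 ≤ c ω := (abs_nonneg _).trans h5.2
      -- Since w.fst ≤ 2c, the combination is at most -(1 - δ/3)δc + (δ/3)2c = -δ(1 - δ)c/3 ≤ 0.
      nlinarith [mul_le_mul_of_nonneg_left h7 (show 0 ≤ 1 - δ / 3 by linarith),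
        mul_nonneg hδ.le h10, mul_nonneg (mul_nonneg hδ.le h10) (sub_nonneg.2 hδ1)]
    · have h8 : w.fst ω ≤ 0 := h2 (by
        rintro (h | h)
        exacts [hω h.1, h7 h.1])
      nlinarith
  · have hsnd : ((1 - δ / 3) • z + (δ / 3) • w).snd =ᵐ[m]
        fun ω => (1 - δ / 3) * z.snd ω + δ / 3 * w.snd ω := by
      rw [WithLp.add_snd, WithLp.smul_snd, WithLp.smul_snd]
      filter_upwards [Lp.coeFn_add ((1 - δ / 3) • z.snd) ((δ / 3) • w.snd),
        Lp.coeFn_smul (1 - δ / 3) z.snd, Lp.coeFn_smul (δ / 3) w.snd] with ω h1 h2 h3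
      rw [h1, Pi.add_apply, h2, h3]
      rfl
    filter_upwards [hsnd, hw2, hz2, hc z hz.1, hc w hwK] with ω h1 h2 h3 h4 h5 hω
    rw [WithLp.sndL_apply, h1, Pi.zero_apply]
    have h6 := h3 hω
    by_cases h7 : z.snd ω ≤ -(δ * c ω)
    · have h9 := abs_le.1 h5.2
      have h10 : 0 ≤ c ω := (abs_nonneg _).trans h5.2
      nlinarith [mul_le_mul_of_nonneg_left h7 (show 0 ≤ 1 - δ / 3 by linarith),
        mul_nonneg hδ.le h10, mul_nonneg (mul_nonneg hδ.le h10) (sub_nonneg.2 hδ1)]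
    · have h8 : w.snd ω ≤ 0 := h2 (Or.inl ⟨hω, h7⟩)
      nlinarith
  · filter_upwards [hw1, hw2, hz1, hz2] with ω h1 h2 h3 h4
    have h5 := abs_nonneg (w.fst ω - z.fst ω)
    have h6 := abs_nonneg (w.snd ω - z.snd ω)
    by_cases hω : ω ∈ α
    · by_cases h7 : z.snd ω ≤ -(δ * c ω)
      · have h8 : w.fst ω ≤ 0 := h1 (by
          rintro (h | h)
          exacts [h.2 h7, h.2 hω])
        have h9 := h4 hω
        have h10 := neg_abs_le (w.fst ω - z.fst ω)
        exact Or.inr (Or.inr ⟨by linarith, by linarith⟩)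
      · refine Or.inr (Or.inl ?_)
        rw [abs_of_nonpos (h4 hω)]
        linarith
    · by_cases h7 : z.fst ω ≤ -(δ * c ω)
      · have h8 : w.snd ω ≤ 0 := h2 (Or.inr ⟨h7, hω⟩)
        have h9 := h3 hω
        have h10 := neg_abs_le (w.snd ω - z.snd ω)
        exact Or.inr (Or.inr ⟨by linarith, by linarith⟩)
      · refine Or.inl ?_
        rw [abs_of_nonpos (h3 hω)]
        linarith

/-- If the points of `K ∩ signCone m α` are within `δ ^ 2` of `v`, then the violation of the sign
condition by `v` has norm of order `δ`. -/
theorem norm_le_of_inter_signCone_subset_closedBall {K : Set (PairL2 m)} (hK : Convex ℝ K)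
    {c : Lp ℝ 2 m} (hc : ∀ z ∈ K, ∀ᵐ ω ∂m, |z.fst ω + z.snd ω| ≤ c ω ∧ |z.snd ω| ≤ c ω)
    (hcone : ∀ β, MeasurableSet β → (K ∩ signCone m β).Nonempty) {α : Set Ω}
    (hα : MeasurableSet α) {v : PairL2 m} {δ : ℝ} (hδ : 0 < δ) (hδ1 : δ ≤ 1)
    (hv : K ∩ signCone m α ⊆ Metric.closedBall v (δ ^ 2)) {F : Lp ℝ 2 m}
    (hF : ∀ᵐ ω ∂m, F ω = signDefect (v.fst ω) (v.snd ω)) :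
    ‖F‖ ≤ δ * (‖c‖ + 14) := by
  obtain ⟨z, hz⟩ := hcone α hα
  obtain ⟨w, hwK, hzw, hsign⟩ := exists_mem_combo_mem_signCone hc hcone hα hz hδ hδ1
  have hzv : ‖z - v‖ ≤ δ ^ 2 := by simpa [dist_eq_norm] using hv hz
  -- Both z and the combination lie within δ² of v, so (δ/3)‖w - z‖ ≤ 2δ².
  have hwz : ‖w - z‖ ≤ 6 * δ := by
    have h1 := hv ⟨hK hz.1 hwK (show 0 ≤ 1 - δ / 3 by linarith) (show 0 ≤ δ / 3 by linarith)
      (by ring), hzw⟩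
    rw [Metric.mem_closedBall, dist_eq_norm] at h1
    have h2 : (δ / 3) • (w - z) = ((1 - δ / 3) • z + (δ / 3) • w - v) - (z - v) := by module
    have h3 := norm_sub_le ((1 - δ / 3) • z + (δ / 3) • w - v) (z - v)
    rw [← h2, norm_smul, Real.norm_of_nonneg (by linarith)] at h3
    have h4 : δ * ‖w - z‖ ≤ δ * (6 * δ) := by nlinarith
    exact le_of_mul_le_mul_left h4 hδ
  have hle : ‖F‖ ≤ ‖δ • c + |w.fst - z.fst| + |w.snd - z.snd| + |z.fst - v.fst| +
      |z.snd - v.snd|‖ := by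
    refine norm_le_of_ae_abs_le ?_
    filter_upwards [hF, hsign, hc z hz.1,
      Lp.coeFn_add (δ • c + |w.fst - z.fst| + |w.snd - z.snd| + |z.fst - v.fst|)
        |z.snd - v.snd|,
      Lp.coeFn_add (δ • c + |w.fst - z.fst| + |w.snd - z.snd|) |z.fst - v.fst|,
      Lp.coeFn_add (δ • c + |w.fst - z.fst|) |w.snd - z.snd|,
      Lp.coeFn_add (δ • c) |w.fst - z.fst|, Lp.coeFn_smul δ c,
      Lp.coeFn_abs (w.fst - z.fst), Lp.coeFn_abs (w.snd - z.snd),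
      Lp.coeFn_abs (z.fst - v.fst), Lp.coeFn_abs (z.snd - v.snd),
      Lp.coeFn_sub w.fst z.fst, Lp.coeFn_sub w.snd z.snd,
      Lp.coeFn_sub z.fst v.fst, Lp.coeFn_sub z.snd v.snd]
      with ω h1 h2 h3 a1 a2 a3 a4 a5 b1 b2 b3 b4 c1 c2 c3 c4
    rw [a1, Pi.add_apply, a2, Pi.add_apply, a3, Pi.add_apply, a4, Pi.add_apply, a5, Pi.smul_apply,
      b1, b2, b3, b4, c1, c2, c3, c4, Pi.sub_apply, Pi.sub_apply, Pi.sub_apply, Pi.sub_apply,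
      smul_eq_mul, h1, abs_of_nonneg (le_max_left _ _)]
    have h4 : 0 ≤ δ * c ω := mul_nonneg hδ.le ((abs_nonneg _).trans h3.2)
    have h5 := abs_nonneg (w.fst ω - z.fst ω)
    have h6 := abs_nonneg (w.snd ω - z.snd ω)
    have h7 := abs_nonneg (z.fst ω - v.fst ω)
    have h8 := abs_nonneg (z.snd ω - v.snd ω)
    refine signDefect_le (by positivity) ?_
    rcases h2 with h | h | h
    · refine Or.inl ?_
      have := abs_sub_abs_le_abs_sub (v.fst ω) (z.fst ω)
      rw [abs_sub_comm] at this
      linarith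
    · refine Or.inr (Or.inl ?_)
      have := abs_sub_abs_le_abs_sub (v.snd ω) (z.snd ω)
      rw [abs_sub_comm] at this
      linarith
    · refine Or.inr (Or.inr ⟨?_, ?_⟩)
      · linarith [h.1, neg_abs_le (z.fst ω - v.fst ω)]
      · linarith [h.2, neg_abs_le (z.snd ω - v.snd ω)]
  have h1 := norm_add_le (δ • c + |w.fst - z.fst| + |w.snd - z.snd| + |z.fst - v.fst|)
    |z.snd - v.snd|
  have h2 := norm_add_le (δ • c + |w.fst - z.fst| + |w.snd - z.snd|) |z.fst - v.fst|
  have h3 := norm_add_le (δ • c + |w.fst - z.fst|) |w.snd - z.snd|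
  have h4 := norm_add_le (δ • c) |w.fst - z.fst|
  rw [norm_abs_eq_norm] at h1 h2 h3 h4
  rw [norm_smul, Real.norm_of_nonneg hδ.le] at h4
  have h5 := WithLp.norm_fst_le _ (w - z)
  have h6 := WithLp.norm_snd_le _ (w - z)
  have h7 := WithLp.norm_fst_le _ (z - v)
  have h8 := WithLp.norm_snd_le _ (z - v)
  rw [WithLp.sub_fst] at h5 h7
  rw [WithLp.sub_snd] at h6 h8
  nlinarith

/-- A closed convex set of pairs with `|f + g| ≤ c` and `g ≤ c` that meets all the cones
`signCone m α` contains a pair satisfying the sign condition of M-stationarity. -/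
theorem exists_mem_mStatSign {K : Set (PairL2 m)} (hK : IsClosed K) (hKconv : Convex ℝ K)
    {c : Lp ℝ 2 m} (hc : ∀ z ∈ K, ∀ᵐ ω ∂m, |z.fst ω + z.snd ω| ≤ c ω ∧ z.snd ω ≤ c ω)
    (hcone : ∀ β, MeasurableSet β → (K ∩ signCone m β).Nonempty) :
    ∃ z ∈ K, MStatSign m z.fst z.snd := by
  obtain ⟨K₁, hK₁⟩ : ∃ K₁ : Set (PairL2 m),
      K₁ = K ∩ (-WithLp.sndL 2 ℝ _ _) ⁻¹' aeLeOn m Set.univ c := ⟨_, rfl⟩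
  have hmem : ∀ z, z ∈ K₁ ↔ z ∈ K ∧ ∀ᵐ ω ∂m, -c ω ≤ z.snd ω := by
    intro z
    rw [hK₁]
    refine and_congr_right fun _ => show (∀ᵐ ω ∂m, ω ∈ Set.univ → (-z.snd) ω ≤ c ω) ↔ _ from
      Filter.eventually_congr ?_
    filter_upwards [Lp.coeFn_neg z.snd] with ω h
    rw [h, Pi.neg_apply, neg_le]
    exact ⟨fun h => h trivial, fun h _ => h⟩
  have hK₁closed : IsClosed K₁ := hK₁ ▸ hK.inter (isClosed_preimage_aeLeOn _ _ _)
  have hK₁conv : Convex ℝ K₁ := hK₁ ▸ hKconv.inter (convex_preimage_aeLeOn _ _ _)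
  have hK₁c : ∀ z ∈ K₁, ∀ᵐ ω ∂m, |z.fst ω + z.snd ω| ≤ c ω ∧ |z.snd ω| ≤ c ω := by
    intro z hz
    filter_upwards [hc z ((hmem z).1 hz).1, ((hmem z).1 hz).2] with ω h1 h2
    exact ⟨h1.1, abs_le.2 ⟨h2, h1.2⟩⟩
  have hK₁bd : Bornology.IsBounded K₁ := by
    refine (Metric.isBounded_closedBall (x := 0) (r := 3 * ‖c‖)).subset fun z hz => ?_
    have h1 : ‖z.snd‖ ≤ ‖c‖ := norm_le_of_ae_abs_le ((hK₁c z hz).mono fun _ h => h.2)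
    have h2 : ‖z.fst + z.snd‖ ≤ ‖c‖ := by
      refine norm_le_of_ae_abs_le ?_
      filter_upwards [hK₁c z hz, Lp.coeFn_add z.fst z.snd] with ω h1 h2
      rw [h2]
      exact h1.1
    have h3 := norm_sub_le (z.fst + z.snd) z.snd
    rw [add_sub_cancel_right] at h3
    rw [mem_closedBall_zero_iff]
    linarith [PairL2.norm_le z]
  have : Nonempty {α : Set Ω // MeasurableSet α} := ⟨⟨∅, MeasurableSet.empty⟩⟩
  obtain ⟨v, hvK, hv⟩ := exists_forall_inter_subset_closedBall
    (H := fun α : {α : Set Ω // MeasurableSet α} => signCone m α.1)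
    (fun α => isClosed_signCone α.1) (fun α => convex_signCone α.1) hK₁closed hK₁conv hK₁bd
    (fun α => by
      obtain ⟨z, hz, hzc⟩ := exists_mem_signCone_neg_le_snd hK hKconv hc hcone α.2
      exact ⟨z, (hmem z).2 ⟨hz.1, hzc⟩, hz.2⟩)
  refine ⟨v, ((hmem v).1 hvK).1, ?_⟩
  obtain ⟨F, hF⟩ : ∃ F : Lp ℝ 2 m, ∀ᵐ ω ∂m, F ω = signDefect (v.fst ω) (v.snd ω) := by
    refine ⟨0 ⊔ (|v.fst| ⊓ |v.snd|) ⊓ (v.fst ⊔ v.snd), ?_⟩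
    filter_upwards [Lp.coeFn_sup 0 ((|v.fst| ⊓ |v.snd|) ⊓ (v.fst ⊔ v.snd)),
      Lp.coeFn_inf (|v.fst| ⊓ |v.snd|) (v.fst ⊔ v.snd), Lp.coeFn_inf |v.fst| |v.snd|,
      Lp.coeFn_sup v.fst v.snd, Lp.coeFn_abs v.fst, Lp.coeFn_abs v.snd, Lp.coeFn_zero ℝ 2 m]
      with ω h1 h2 h3 h4 h5 h6 h7
    rw [h1, Pi.sup_apply, h2, Pi.inf_apply, h3, Pi.inf_apply, h4, Pi.sup_apply, h5, h6, h7]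
    rfl
  have hFle : ∀ δ : ℝ, 0 < δ → δ ≤ 1 → ‖F‖ ≤ δ * (‖c‖ + 14) := by
    intro δ hδ hδ1
    obtain ⟨K', hK', hK'conv, hK'H, α, hα⟩ := hv (δ ^ 2) (by positivity)
    exact norm_le_of_inter_signCone_subset_closedBall hK'conv (fun z hz => hK₁c z (hK' hz))
      (fun β hβ => hK'H ⟨β, hβ⟩) α.2 hδ hδ1 hα hF
  have hF0 : F = 0 := by
    by_contra hne
    have h1 : 0 < ‖F‖ := norm_pos_iff.2 hne
    have h2 : 0 < ‖c‖ + 14 := by positivity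
    have h3 := hFle (min 1 (‖F‖ / (‖c‖ + 14) / 2)) (by positivity) (min_le_left _ _)
    have h4 := h3.trans (mul_le_mul_of_nonneg_right (min_le_right _ _) h2.le)
    have h5 : ‖F‖ / (‖c‖ + 14) / 2 * (‖c‖ + 14) = ‖F‖ / 2 := by field_simp
    linarith
  have h0 := Lp.coeFn_zero ℝ 2 m
  rw [← hF0] at h0
  filter_upwards [hF, h0] with ω h1 h2
  refine neg_and_neg_or_mul_eq_zero_of_signDefect_le_zero ?_
  rw [← h1, h2, Pi.zero_apply]

end PairL2

/-! ### Passing the bounds to the closed convex hull, and the theorem. -/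

theorem mem_aeLeOn_of_mem_closedConvexHull {Ω : Type*} [MeasurableSpace Ω] {m : Measure Ω}
    {X : Type*} [NormedAddCommGroup X] [NormedSpace ℝ X] (Λ : X →L[ℝ] Lp ℝ 2 m) {S : Set X}
    {s : Set Ω} {g : Ω → ℝ} (hS : ∀ x ∈ S, Λ x ∈ aeLeOn m s g) {x : X}
    (hx : x ∈ closedConvexHull ℝ S) : Λ x ∈ aeLeOn m s g :=
  closedConvexHull_min hS (convex_preimage_aeLeOn Λ s g) (isClosed_preimage_aeLeOn Λ s g) hx

theorem mainTheorem9
    {Ω : Type*} [MeasurableSpace Ω] (m : Measure Ω)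
    {Y : Type*} [NormedAddCommGroup Y] [NormedSpace ℝ Y] [CompleteSpace Y]
    (hY : IsReflexiveSpace Y)
    (μ ν : {α : Set Ω // MeasurableSet α} → Lp ℝ 2 m)
    (ρ : {α : Set Ω // MeasurableSet α} → Y)
    (hμ : ∀ α, ∀ᵐ ω ∂m, ω ∉ α.1 → μ α ω ≤ 0)
    (hν : ∀ α, ∀ᵐ ω ∂m, ω ∈ α.1 → ν α ω ≤ 0)
    (c₀ : Lp ℝ 2 m)
    (c₁ : {α : Set Ω // MeasurableSet α} → ℝ) (hc₁ : ∀ α, 0 < c₁ α)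
    (hmax : ∀ α, ∀ᵐ ω ∂m, max |μ α ω + ν α ω| (ν α ω) ≤ c₀ ω)
    (habs : ∀ α, ∀ᵐ ω ∂m, |ν α ω| ≤ c₁ α * c₀ ω)
    (T : Lp ℝ 2 m →L[ℝ] Y)
    (c₂ : ℝ) (hc₂ : 0 < c₂)
    (hρ : ∀ α, ‖ρ α - T (ν α)‖ ≤ c₂) :
    ∃ (μbar νbar : Lp ℝ 2 m) (ρbar : Y),
      (μbar, νbar, ρbar) ∈ closedConvexHull ℝ (Set.range fun α => (μ α, ν α, ρ α)) ∧
      MStatSign m μbar νbar := by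
  obtain ⟨D, hD⟩ : ∃ D, D = closedConvexHull ℝ (Set.range fun α => (μ α, ν α, ρ α)) := ⟨_, rfl⟩
  have hDclosed : IsClosed D := hD ▸ isClosed_closedConvexHull
  have hDconv : Convex ℝ D := hD ▸ convex_closedConvexHull
  have hDmem : ∀ α, (μ α, ν α, ρ α) ∈ D := fun α =>
    hD ▸ subset_closedConvexHull (Set.mem_range_self α)
  obtain ⟨N, hN⟩ : ∃ N : Lp ℝ 2 m × Lp ℝ 2 m × Y →L[ℝ] Lp ℝ 2 m, ∀ p, N p = p.2.1 :=
    ⟨(ContinuousLinearMap.fst ℝ _ _).comp (ContinuousLinearMap.snd ℝ _ _), fun _ => rfl⟩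
  obtain ⟨S, hS⟩ : ∃ S : Lp ℝ 2 m × Lp ℝ 2 m × Y →L[ℝ] Lp ℝ 2 m, ∀ p, S p = p.1 + p.2.1 :=
    ⟨ContinuousLinearMap.fst ℝ _ _ + N, fun p => congrArg (p.1 + ·) (hN p)⟩
  obtain ⟨P, hP⟩ : ∃ P : Lp ℝ 2 m × Lp ℝ 2 m × Y →L[ℝ] Y, ∀ p, P p = p.2.2 - T p.2.1 :=
    ⟨(ContinuousLinearMap.snd ℝ _ _).comp (ContinuousLinearMap.snd ℝ _ _) - T.comp N,
      fun p => congrArg (p.2.2 - T ·) (hN p)⟩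
  have hDN : ∀ p ∈ D, ∀ᵐ ω ∂m, p.2.1 ω ≤ c₀ ω := by
    intro p hp
    rw [hD] at hp
    have h := mem_aeLeOn_of_mem_closedConvexHull N (s := Set.univ) (g := c₀) (by
      rintro _ ⟨α, rfl⟩
      rw [hN]
      filter_upwards [hmax α] with ω h _ using (le_max_right _ _).trans h) hp
    rw [hN] at h
    filter_upwards [h] with ω h using h trivial
  have hDS : ∀ p ∈ D, ∀ᵐ ω ∂m, |p.1 ω + p.2.1 ω| ≤ c₀ ω := by
    intro p hp
    rw [hD] at hp
    have h := mem_aeLeOn_of_mem_closedConvexHull S (s := Set.univ) (g := c₀) (by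
      rintro _ ⟨α, rfl⟩
      rw [hS]
      filter_upwards [hmax α, Lp.coeFn_add (μ α) (ν α)] with ω h h2 _
      rw [h2]
      exact (le_abs_self _).trans ((le_max_left _ _).trans h)) hp
    have h' := mem_aeLeOn_of_mem_closedConvexHull (-S) (s := Set.univ) (g := c₀) (by
      rintro _ ⟨α, rfl⟩
      rw [neg_apply, hS]
      filter_upwards [hmax α, Lp.coeFn_add (μ α) (ν α), Lp.coeFn_neg (μ α + ν α)] with ω h h2 h3 _
      rw [h3, Pi.neg_apply, h2]
      exact (neg_le_abs _).trans ((le_max_left _ _).trans h)) hp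
    rw [hS] at h
    rw [neg_apply, hS] at h'
    filter_upwards [h, h', Lp.coeFn_add p.1 p.2.1, Lp.coeFn_neg (p.1 + p.2.1)] with ω h1 h2 h3 h4
    have h1 := h1 trivial
    have h2 := h2 trivial
    rw [h3] at h1
    rw [h4, Pi.neg_apply, h3] at h2
    exact abs_le'.2 ⟨h1, h2⟩
  have hDP : ∀ p ∈ D, ‖p.2.2 - T p.2.1‖ ≤ c₂ := by
    intro p hp
    rw [hD] at hp
    have h : p ∈ P ⁻¹' Metric.closedBall 0 c₂ := closedConvexHull_min (by
      rintro _ ⟨α, rfl⟩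
      have h : ‖P (μ α, ν α, ρ α)‖ ≤ c₂ := by
        rw [hP]
        exact hρ α
      exact mem_closedBall_zero_iff.2 h) ((convex_closedBall 0 c₂).linear_preimage P.toLinearMap)
      (Metric.isClosed_closedBall.preimage P.continuous) hp
    rwa [Set.mem_preimage, hP, mem_closedBall_zero_iff] at h
  obtain ⟨Θ, hΘ⟩ : ∃ Θ : PairL2 m × Y →L[ℝ] Lp ℝ 2 m × Lp ℝ 2 m × Y,
      ∀ p, Θ p = (p.1.fst, p.1.snd, p.2) :=
    ⟨((WithLp.fstL 2 ℝ _ _).comp (ContinuousLinearMap.fst ℝ _ _)).prod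
      (((WithLp.sndL 2 ℝ _ _).comp (ContinuousLinearMap.fst ℝ _ _)).prod
        (ContinuousLinearMap.snd ℝ _ _)), fun _ => rfl⟩
  have hKclosed : IsClosed (Prod.fst '' (Θ ⁻¹' D)) := by
    refine hY.isClosed_image_fst (hDclosed.preimage Θ.continuous)
      (hDconv.linear_preimage Θ.toLinearMap) (norm_nonneg T) (b := c₂) fun p hp => ?_
    have h1 := hDP _ hp
    rw [hΘ] at h1
    have h2 := norm_add_le (p.2 - T p.1.snd) (T p.1.snd)
    rw [sub_add_cancel] at h2
    have h3 := (T.le_opNorm p.1.snd).trans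
      (mul_le_mul_of_nonneg_left (WithLp.norm_snd_le _ p.1) (norm_nonneg T))
    linarith
  have hKconv : Convex ℝ (Prod.fst '' (Θ ⁻¹' D)) :=
    (hDconv.linear_preimage Θ.toLinearMap).linear_image (LinearMap.fst ℝ _ _)
  have hKmem : ∀ z ∈ Prod.fst '' (Θ ⁻¹' D), ∃ y, (z.fst, z.snd, y) ∈ D := by
    rintro _ ⟨p, hp, rfl⟩
    rw [Set.mem_preimage, hΘ] at hp
    exact ⟨p.2, hp⟩
  obtain ⟨z, hz, hsign⟩ := exists_mem_mStatSign hKclosed hKconv (c := c₀)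
    (fun z hz => by
      obtain ⟨y, hy⟩ := hKmem z hz
      filter_upwards [hDS _ hy, hDN _ hy] with ω h1 h2 using ⟨h1, h2⟩)
    (fun β hβ => ⟨WithLp.toLp 2 (μ ⟨β, hβ⟩, ν ⟨β, hβ⟩),
      ⟨(WithLp.toLp 2 (μ ⟨β, hβ⟩, ν ⟨β, hβ⟩), ρ ⟨β, hβ⟩), by
        rw [Set.mem_preimage, hΘ]
        exact hDmem ⟨β, hβ⟩, rfl⟩, hμ ⟨β, hβ⟩, hν ⟨β, hβ⟩⟩)
  obtain ⟨y, hy⟩ := hKmem z hz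
  exact ⟨z.fst, z.snd, y, hD ▸ hy, hsign⟩
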